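/- Let $K\ge 1$, let $F^{(1)},\dots,F^{(K)}$ be arbitrary probability distributions on $\mathbb R$ (no continuity or moment condition), and let $\alpha\in(0,1)$. Consider the $K$-armed bandit in which the $n$-th pull of arm $i$ yields $X^{(i)}_n\sim F^{(i)}$, all $X^{(i)}_n$ ($1\le i\le K$, $n\ge 1$) being mutually independent, and let $V$ be a random element that is independent of the rewards. An admissible policy $\pi=(\pi_1,\pi_2,\dots)$ chooses the arm $\pi_t$ as a measurable function of $V$, the earlier actions $\pi_1,\dots,\pi_{t-1}$ and the earlier rewards $X^{\pi}_1,\dots,X^{\pi}_{t-1}$, where $X^{\pi}_t=X^{(i)}_{\tau_i(t)}$ if $\pi_t=i$, with $\tau_i(t)=\#\{s\le t:\pi_s=i\}$. Let $\hat F^{\pi}_t(y)=\frac1t\#\{s\le t: X^{\pi}_s\le y\}$, let $\mathrm{VaR}_\alpha(F)=\inf\{y\in\mathbb R: F(y)\ge\alpha\}$, and let $R^\pi=\liminf_{t\to\infty}\mathrm{VaR}_\alpha(\hat F^\pi_t)$. A policy is simple if $\pi_1,\pi_2,\dots$ are $\sigma(V)$-measurable and i.i.d., and deterministic simple if moreover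 $\mathbb P(\pi_1=i)=1$ for some arm $i$. Then for every admissible policy $\pi$ the random variable $R^\pi$ is almost surely finite and integrable, and there is an arm $i^*$, depending only on $\alpha$ and $F^{(1)},\dots,F^{(K)}$, such that the deterministic simple policy $\pi^*$ that always pulls $i^*$ is an infinite-horizon oracle policy, that is, $$\mathbb E[R^{\pi}]\le\mathbb E[R^{\pi^*}]\qquad\text{for every admissible policy }\pi .$$ -/

import Mathlib

open MeasureTheory ProbabilityTheory Filter

noncomputable section

namespace BanditEDPM

/-- The empirical distribution function of `x 0, …, x (t - 1)`:
`y ↦ (1 / t) * #{s | x s ≤ y}`. -/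
def empiricalCDF {t : ℕ} (x : Fin t → ℝ) (y : ℝ) : ℝ :=
  (1 / (t : ℝ)) * ∑ s : Fin t, (Set.Ici (x s)).indicator (fun _ => (1 : ℝ)) y

/-- Value at Risk at level `α` of a distribution function `F`: `inf {y | F y ≥ α}`. -/
def VaR (α : ℝ) (F : ℝ → ℝ) : ℝ :=
  sInf {y : ℝ | α ≤ F y}

section Model

variable {Ω 𝕍 : Type*} [MeasurableSpace Ω] [MeasurableSpace 𝕍] {K : ℕ}

/-- The bandit model with arm distributions `F i` on the probability space `(Ω, P)`:
`X i n` is the reward of the pull of arm `i` that is preceded by exactly `n` pulls of that arm.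
All the rewards are mutually independent, `X i n` has law `F i`, and the randomisation variable
`V` of the policies is independent of the whole family of rewards. -/
structure IsBandit (P : Measure Ω) (F : Fin K → Measure ℝ) (V : Ω → 𝕍)
    (X : Fin K → ℕ → Ω → ℝ) : Prop where
  measurable_V : Measurable V
  measurable_X : ∀ i n, Measurable (X i n)
  law_X : ∀ i n, P.map (X i n) = F i
  iIndepFun_X : iIndepFun (fun (p : Fin K × ℕ) => X p.1 p.2) P
  indepFun_V : IndepFun V (fun ω (p : Fin K × ℕ) => X p.1 p.2 ω) P

/-- The number of pulls of arm `i` before time `t` (times are `0, 1, 2, …`) under the action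
process `π`. -/
def pullCount (π : ℕ → Ω → Fin K) (i : Fin K) (t : ℕ) (ω : Ω) : ℕ :=
  ((Finset.range t).filter (fun s => π s ω = i)).card

/-- The reward received at time `t`. -/
def reward (X : Fin K → ℕ → Ω → ℝ) (π : ℕ → Ω → Fin K) (t : ℕ) (ω : Ω) : ℝ :=
  X (π t ω) (pullCount π (π t ω) t ω) ω

/-- Admissible policies: the action at time `t` is a measurable function of `V`, of the earlier
actions and of the earlier rewards. -/
def IsAdmissible (V : Ω → 𝕍) (X : Fin K → ℕ → Ω → ℝ) (π : ℕ → Ω → Fin K) : Prop :=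
  ∀ t : ℕ, ∃ f : 𝕍 × (Fin t → Fin K) × (Fin t → ℝ) → Fin K, Measurable f ∧
    ∀ ω, π t ω = f (V ω, (fun s => π s ω), (fun s => reward X π s ω))

/-- Simple policies: admissible policies whose actions are `σ(V)`-measurable and i.i.d. -/
def IsSimple (P : Measure Ω) (V : Ω → 𝕍) (X : Fin K → ℕ → Ω → ℝ)
    (π : ℕ → Ω → Fin K) : Prop :=
  IsAdmissible V X π ∧
  (∀ t, Measurable[MeasurableSpace.comap V inferInstance] (π t)) ∧
  iIndepFun π P ∧
  ∀ t, IdentDistrib (π t) (π 0) P P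

/-- Deterministic simple policies: simple policies that pull one fixed arm almost surely. -/
def IsDeterministicSimple (P : Measure Ω) (V : Ω → 𝕍) (X : Fin K → ℕ → Ω → ℝ)
    (π : ℕ → Ω → Fin K) : Prop :=
  IsSimple P V X π ∧ ∃ i, P {ω | π 0 ω = i} = 1

/-- The worst case asymptotic performance `liminf_t R(F̂_t)` of a policy for the performance
measure `R`, where `F̂_t` is the empirical distribution function of the first `t` rewards. -/
def performance (X : Fin K → ℕ → Ω → ℝ) (R : (ℝ → ℝ) → ℝ) (π : ℕ → Ω → Fin K)
    (ω : Ω) : EReal :=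
  liminf (fun t : ℕ =>
    ((R (empiricalCDF (fun s : Fin t => reward X π s ω)) : ℝ) : EReal)) atTop

/-- The asymptotic performance is almost surely finite and has a finite expectation. -/
def HasExpectedPerformance (P : Measure Ω) (X : Fin K → ℕ → Ω → ℝ) (R : (ℝ → ℝ) → ℝ)
    (π : ℕ → Ω → Fin K) : Prop :=
  (∀ᵐ ω ∂P, performance X R π ω ≠ ⊥ ∧ performance X R π ω ≠ ⊤) ∧
  Integrable (fun ω => (performance X R π ω).toReal) P

/-- The expected asymptotic performance `E[liminf_t R(F̂_t)]`
(meaningful when `HasExpectedPerformance` holds). -/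
def expectedPerformance (P : Measure Ω) (X : Fin K → ℕ → Ω → ℝ) (R : (ℝ → ℝ) → ℝ)
    (π : ℕ → Ω → Fin K) : ℝ :=
  ∫ ω, (performance X R π ω).toReal ∂P

/-- Infinite horizon oracle policies: the expected asymptotic performance of every admissible
policy is well defined and finite, and `π` attains the maximum. -/
def IsInfiniteHorizonOracle (P : Measure Ω) (V : Ω → 𝕍) (X : Fin K → ℕ → Ω → ℝ)
    (R : (ℝ → ℝ) → ℝ) (π : ℕ → Ω → Fin K) : Prop :=
  IsAdmissible V X π ∧
  ∀ π' : ℕ → Ω → Fin K, IsAdmissible V X π' →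
    HasExpectedPerformance P X R π' ∧
    expectedPerformance P X R π' ≤ expectedPerformance P X R π

end Model

end BanditEDPM

end

noncomputable section

namespace BanditEDPM

open Topology

variable {Ω 𝕍 : Type*} {K : ℕ}

/-! The best arm is one with the largest `VaR`. Let `v` be that maximum. By right continuity every
arm gives mass at least `α` to `(-∞, v]`, so the number of rewards at most `v`, minus the sum of the
pulled arms' masses, is a martingale with bounded increments. Almost surely such a martingale is
bounded above only if it converges. If the proportion of rewards at most `v` were eventually below
`α`, the martingale would be eventually nonpositive, hence convergent, and its increments would tend
to `0`. A reward above `v` gives an increment at most `-α`, so all late rewards would be at most `v`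
and the proportion would tend to `1`, a contradiction. So the empirical `VaR` is at most `v`
infinitely often, and its liminf is at most `v` (`IsBandit.ae_frequently_le_count`,
`IsBandit.ae_performance_le`).

Conversely, let `w` be a lower bound for the `VaR` of all pulled arms. For `y < w` the strong law,
applied arm by arm, makes the proportion of rewards at most `y` eventually less than `α`, so the
liminf is at least `w` (`IsBandit.ae_eventually_count_lt`, `IsBandit.le_ae_performance`). The
smallest `VaR` as `w` gives integrability for every policy; for the best arm alone `w = v`.

The martingale property needs the current reward to be independent of the past, although its index
is random. This is proved for each fixed index `(i, n)`: before that pull, the course of the policy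
is a function of `V` and the other rewards (`IsAdmissible.measurable_masked`). -/

/-! ### Independence of one reward from the randomisation and all other rewards -/

/-- The two hypotheses factor the joint law as `P_A ⊗ (P_B ⊗ P_C)`; reassociating the product gives
the claim. -/
lemma indepFun_prodMk_left {Ω α β γ : Type*} {m : MeasurableSpace Ω} [MeasurableSpace α]
    [MeasurableSpace β] [MeasurableSpace γ] {P : Measure Ω} [IsProbabilityMeasure P]
    {A : Ω → α} {B : Ω → β} {C : Ω → γ} (hA : Measurable A) (hB : Measurable B)
    (hC : Measurable C) (hABC : IndepFun A (fun ω => (B ω, C ω)) P) (hBC : IndepFun B C P) :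
    IndepFun (fun ω => (A ω, B ω)) C P := by
  have hAB : IndepFun A B P := hABC.comp measurable_id measurable_fst
  have := Measure.isProbabilityMeasure_map (μ := P) hA.aemeasurable
  have := Measure.isProbabilityMeasure_map (μ := P) hB.aemeasurable
  have := Measure.isProbabilityMeasure_map (μ := P) hC.aemeasurable
  rw [indepFun_iff_map_prod_eq_prod_map_map (hA.prodMk hB).aemeasurable hC.aemeasurable,
    hAB.map_prod_eq_prod_map_map hA.aemeasurable hB.aemeasurable]
  have h1 := hABC.map_prod_eq_prod_map_map hA.aemeasurable (hB.prodMk hC).aemeasurable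
  rw [hBC.map_prod_eq_prod_map_map hB.aemeasurable hC.aemeasurable] at h1
  have h2 := (MeasurePreserving.symm _ (measurePreserving_prodAssoc
    (P.map A) (P.map B) (P.map C))).map_eq
  rw [← h2, ← h1, Measure.map_map (MeasurableEquiv.measurable _)
    (hA.prodMk (hB.prodMk hC))]
  rfl

/-- The family of rewards, with the reward `X i n` replaced by `0`. -/
def zeroAt (X : Fin K → ℕ → Ω → ℝ) (i : Fin K) (n : ℕ) (p : Fin K × ℕ) (ω : Ω) : ℝ :=
  if p = (i, n) then 0 else X p.1 p.2 ω

/-- The randomisation variable together with all the rewards except `X i n`. -/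
def othersThan (V : Ω → 𝕍) (X : Fin K → ℕ → Ω → ℝ) (i : Fin K) (n : ℕ) (ω : Ω) :
    𝕍 × (Fin K × ℕ → ℝ) :=
  (V ω, fun p => zeroAt X i n p ω)

lemma measurable_zeroAt {m : MeasurableSpace Ω} {X : Fin K → ℕ → Ω → ℝ} {i : Fin K} {n : ℕ}
    (hX : ∀ j k, (j, k) ≠ (i, n) → Measurable (X j k)) (p : Fin K × ℕ) :
    Measurable (zeroAt X i n p) := by
  by_cases hp : p = (i, n)
  · rw [show zeroAt X i n p = fun _ => 0 from funext fun ω => if_pos hp]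
    exact measurable_const
  · rw [show zeroAt X i n p = X p.1 p.2 from funext fun ω => if_neg hp]
    exact hX p.1 p.2 hp

/-- `V` is independent of the whole reward array, and inside the array the index sets `{(i, n)}ᶜ`
and `{(i, n)}` are disjoint. -/
lemma IsBandit.indepFun_othersThan [MeasurableSpace Ω] [MeasurableSpace 𝕍] {P : Measure Ω}
    [IsProbabilityMeasure P] {F : Fin K → Measure ℝ} {V : Ω → 𝕍} {X : Fin K → ℕ → Ω → ℝ}
    (h : IsBandit P F V X) (i : Fin K) (n : ℕ) :
    IndepFun (othersThan V X i n) (X i n) P := by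
  have hup : Measurable (fun (x : Fin K × ℕ → ℝ) p => if p = (i, n) then 0 else x p) := by
    refine measurable_pi_lambda _ fun p => ?_
    by_cases hp : p = (i, n)
    · simp [hp]
    · simpa [hp] using measurable_pi_apply p
  refine indepFun_prodMk_left h.measurable_V
    (measurable_pi_lambda _ (measurable_zeroAt fun j k _ => h.measurable_X j k))
    (h.measurable_X i n) ?_ ?_
  · exact h.indepFun_V.comp measurable_id (hup.prodMk (measurable_pi_apply (i, n)))
  · have h1 := indep_iSup_of_disjoint (fun p => (h.measurable_X p.1 p.2).comap_le)
      ((iIndepFun_iff_iIndep _ _ P).1 h.iIndepFun_X)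
      (disjoint_compl_left : Disjoint ({(i, n)}ᶜ : Set (Fin K × ℕ)) {(i, n)})
    refine indep_of_indep_of_le_left (indep_of_indep_of_le_right h1 ?_) ?_
    · exact le_iSup₂_of_le (i, n) rfl le_rfl
    · rw [← measurable_iff_comap_le]
      refine @measurable_pi_lambda _ _ _ (_) _ _ (@measurable_zeroAt _ _ (_) _ _ _ fun j k hjk => ?_)
      rw [measurable_iff_comap_le]
      exact le_iSup₂_of_le (f := fun p (_ : p ∈ ({(i, n)}ᶜ : Set (Fin K × ℕ))) =>
        MeasurableSpace.comap (X p.1 p.2) inferInstance) (j, k) hjk le_rfl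

lemma measurable_apply_of_countable {m : MeasurableSpace Ω} {ι β : Type*} [Countable ι]
    [MeasurableSpace ι] [MeasurableSingletonClass ι] [MeasurableSpace β] {Y : ι → Ω → β}
    {g : Ω → ι}
    (hY : ∀ p, Measurable (Y p)) (hg : Measurable g) : Measurable (fun ω => Y (g ω) ω) := by
  have : Measurable (fun q : Ω × ι => Y q.2 q.1) :=
    measurable_from_prod_countable_left hY
  exact this.comp (measurable_id.prodMk hg)

/-! ### Pull counts, and the course of a policy before a given reward is seen -/

lemma pullCount_succ (π : ℕ → Ω → Fin K) (i : Fin K) (t : ℕ) (ω : Ω) :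
    pullCount π i (t + 1) ω = pullCount π i t ω + if π t ω = i then 1 else 0 := by
  unfold pullCount
  rw [Finset.range_add_one, Finset.filter_insert]
  split_ifs <;> simp

lemma pullCount_mono (π : ℕ → Ω → Fin K) (i : Fin K) (ω : Ω) :
    Monotone (fun t => pullCount π i t ω) :=
  monotone_nat_of_le_succ fun t => by simp [pullCount_succ]

lemma pullCount_le (π : ℕ → Ω → Fin K) (i : Fin K) (t : ℕ) (ω : Ω) :
    pullCount π i t ω ≤ t := by
  unfold pullCount
  exact (Finset.card_filter_le _ _).trans (by simp)

lemma measurable_pullCount {m : MeasurableSpace Ω} {π : ℕ → Ω → Fin K} {t : ℕ}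
    (hπ : ∀ s < t, Measurable (π s)) (i : Fin K) : Measurable (pullCount π i t) := by
  induction t with
  | zero => exact measurable_const (a := 0)
  | succ t ih =>
    rw [show pullCount π i (t + 1) = _ from funext (pullCount_succ π i t)]
    exact (ih fun s hs => hπ s (by omega)).add
      (Measurable.ite (hπ t (by omega) (measurableSet_singleton i)) measurable_const
        measurable_const)

/-- The action at time `t`, replaced by `i` once arm `i` has been pulled more than `n` times. -/
def maskedAction (π : ℕ → Ω → Fin K) (i : Fin K) (n t : ℕ) (ω : Ω) : Fin K :=
  if pullCount π i t ω ≤ n then π t ω else i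

/-- The reward at time `t`, replaced by `0` once arm `i` has been pulled more than `n` times. -/
def maskedReward (X : Fin K → ℕ → Ω → ℝ) (π : ℕ → Ω → Fin K) (i : Fin K) (n t : ℕ) (ω : Ω) : ℝ :=
  if pullCount π i (t + 1) ω ≤ n then reward X π t ω else 0

lemma maskedAction_eq {π : ℕ → Ω → Fin K} {i : Fin K} {n s t : ℕ} {ω : Ω}
    (h : pullCount π i t ω ≤ n) (hs : s ≤ t) : maskedAction π i n s ω = π s ω :=
  if_pos ((pullCount_mono π i ω hs).trans h)

lemma maskedReward_eq {X : Fin K → ℕ → Ω → ℝ} {π : ℕ → Ω → Fin K} {i : Fin K} {n s t : ℕ} {ω : Ω}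
    (h : pullCount π i t ω ≤ n) (hs : s < t) : maskedReward X π i n s ω = reward X π s ω :=
  if_pos ((pullCount_mono π i ω hs).trans h)

lemma pullCount_maskedAction {π : ℕ → Ω → Fin K} {i : Fin K} {n t : ℕ} {ω : Ω}
    (h : pullCount π i t ω ≤ n) (j : Fin K) :
    pullCount (maskedAction π i n) j t ω = pullCount π j t ω := by
  unfold pullCount
  congr 1
  refine Finset.filter_congr fun s hs => ?_
  rw [maskedAction_eq h (Finset.mem_range.1 hs).le]

/-- Masking only turns actions into `i`, so it cannot lower the count of `i`; below the threshold it
changes nothing. Hence the threshold event can be read off the masked actions alone. -/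
lemma pullCount_maskedAction_le_iff {π : ℕ → Ω → Fin K} {i : Fin K} {n t : ℕ} {ω : Ω} :
    pullCount (maskedAction π i n) i t ω ≤ n ↔ pullCount π i t ω ≤ n := by
  refine ⟨fun h => le_trans (Finset.card_le_card (Finset.monotone_filter_right _ fun s _ hs => ?_)) h,
    fun h => (pullCount_maskedAction h i).trans_le h⟩
  unfold maskedAction
  split_ifs
  exacts [hs, rfl]

/-- As long as arm `i` has been pulled at most `n` times, the course of an admissible policy does
not depend on the reward `X i n`. -/
lemma IsAdmissible.measurable_masked {m : MeasurableSpace Ω} [MeasurableSpace 𝕍] {V : Ω → 𝕍}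
    {X : Fin K → ℕ → Ω → ℝ} {π : ℕ → Ω → Fin K} (hπ : IsAdmissible V X π) {i : Fin K} {n : ℕ}
    (hV : Measurable V) (hX : ∀ j k, (j, k) ≠ (i, n) → Measurable (X j k)) (t : ℕ) :
    Measurable (maskedAction π i n t) ∧ Measurable (maskedReward X π i n t) := by
  induction t using Nat.strong_induction_on with
  | _ t ih =>
  have hset : ∀ u, (∀ s < u, Measurable (maskedAction π i n s)) →
      MeasurableSet {ω | pullCount π i u ω ≤ n} := by
    intro u hu
    have := measurable_pullCount hu i (measurableSet_Iic (a := n))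
    simpa only [Set.preimage, Set.mem_Iic, pullCount_maskedAction_le_iff] using this
  have hA : Measurable (maskedAction π i n t) := by
    obtain ⟨f, hf, hft⟩ := hπ t
    have heq : maskedAction π i n t = fun ω => if pullCount π i t ω ≤ n then
        f (V ω, (fun s : Fin t => maskedAction π i n s ω),
          (fun s : Fin t => maskedReward X π i n s ω)) else i := by
      funext ω
      by_cases h : pullCount π i t ω ≤ n
      · rw [maskedAction_eq h le_rfl, if_pos h, hft ω]
        rw [show (fun s : Fin t => π s ω) = fun s : Fin t => maskedAction π i n s ω from
            funext fun s : Fin t => (maskedAction_eq h s.2.le).symm,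
          show (fun s : Fin t => reward X π s ω) = fun s : Fin t => maskedReward X π i n s ω from
            funext fun s : Fin t => (maskedReward_eq h s.2).symm]
      · simp [maskedAction, h]
    rw [heq]
    refine Measurable.ite (hset t fun s hs => (ih s hs).1) (hf.comp ?_) measurable_const
    exact hV.prodMk ((measurable_pi_lambda _ fun s : Fin t => (ih s s.2).1).prodMk
      (measurable_pi_lambda _ fun s : Fin t => (ih s s.2).2))
  have hA' : ∀ s < t + 1, Measurable (maskedAction π i n s) := fun s hs =>
    (Nat.lt_succ_iff_lt_or_eq.1 hs).elim (fun h => (ih s h).1) (fun h => h ▸ hA)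
  refine ⟨hA, ?_⟩
  have heq : maskedReward X π i n t = fun ω => if pullCount π i (t + 1) ω ≤ n then
      zeroAt X i n (maskedAction π i n t ω,
        pullCount (maskedAction π i n) (maskedAction π i n t ω) t ω) ω else 0 := by
    funext ω
    by_cases h : pullCount π i (t + 1) ω ≤ n
    · have h' : pullCount π i t ω ≤ n := (pullCount_mono π i ω t.le_succ).trans h
      simp only [maskedReward, h, if_true]
      rw [maskedAction_eq h t.le_succ, pullCount_maskedAction h', zeroAt, if_neg]
      · rfl
      · intro hc
        obtain ⟨h1, h2⟩ := Prod.mk.inj hc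
        rw [h1] at h2
        rw [pullCount_succ, if_pos h1, h2] at h
        omega
    · simp [maskedReward, h]
  rw [heq]
  refine Measurable.ite (hset (t + 1) hA') ?_ measurable_const
  have hN : Measurable fun ω => pullCount (maskedAction π i n) (maskedAction π i n t ω) t ω :=
    measurable_apply_of_countable (Y := fun j ω => pullCount (maskedAction π i n) j t ω)
      (fun j => measurable_pullCount (fun s hs => (ih s hs).1) j) hA
  have hp : Measurable fun ω => (maskedAction π i n t ω,
      pullCount (maskedAction π i n) (maskedAction π i n t ω) t ω) := hA.prodMk hN
  exact measurable_apply_of_countable (measurable_zeroAt hX) hp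

lemma IsAdmissible.measurableSet_pullCount_le {m : MeasurableSpace Ω} [MeasurableSpace 𝕍]
    {V : Ω → 𝕍} {X : Fin K → ℕ → Ω → ℝ} {π : ℕ → Ω → Fin K} (hπ : IsAdmissible V X π)
    {i : Fin K} {n : ℕ} (hV : Measurable V)
    (hX : ∀ j k, (j, k) ≠ (i, n) → Measurable (X j k)) (t : ℕ) :
    MeasurableSet {ω | pullCount π i t ω ≤ n} := by
  have := measurable_pullCount (t := t) (fun s _ => (hπ.measurable_masked hV hX s).1) i
    (measurableSet_Iic (a := n))
  simpa only [Set.preimage, Set.mem_Iic, pullCount_maskedAction_le_iff] using this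

lemma IsAdmissible.measurable {m : MeasurableSpace Ω} [MeasurableSpace 𝕍] {V : Ω → 𝕍}
    {X : Fin K → ℕ → Ω → ℝ} {π : ℕ → Ω → Fin K} (hπ : IsAdmissible V X π)
    (hV : Measurable V) (hX : ∀ j k, Measurable (X j k)) (t : ℕ) :
    Measurable (π t) ∧ Measurable (reward X π t) := by
  rcases isEmpty_or_nonempty Ω with h | ⟨⟨ω₀⟩⟩
  · exact ⟨measurable_of_empty _, measurable_of_empty _⟩
  · have h := hπ.measurable_masked (i := π 0 ω₀) (n := t + 1) hV (fun j k _ => hX j k) t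
    rwa [show maskedAction π (π 0 ω₀) (t + 1) t = π t from
        funext fun ω => maskedAction_eq (pullCount_le _ _ _ ω) t.le_succ,
      show maskedReward X π (π 0 ω₀) (t + 1) t = reward X π t from
        funext fun ω => maskedReward_eq (pullCount_le _ _ _ ω) t.lt_succ_self] at h

/-! ### The deviation martingale -/

/-- The actions and the rewards before time `t`. -/
def history (X : Fin K → ℕ → Ω → ℝ) (π : ℕ → Ω → Fin K) (t : ℕ) (ω : Ω) : Fin t → Fin K × ℝ :=
  fun s => (π s ω, reward X π s ω)

/-- The filtration generated by the actions and the rewards. -/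
def historyFiltration [m : MeasurableSpace Ω] {X : Fin K → ℕ → Ω → ℝ} {π : ℕ → Ω → Fin K}
    (h : ∀ t, Measurable (π t) ∧ Measurable (reward X π t)) : Filtration ℕ m where
  seq t := MeasurableSpace.comap (history X π t) inferInstance
  mono' s t hst := by
    rw [← measurable_iff_comap_le]
    have : Measurable (fun (x : Fin t → Fin K × ℝ) (u : Fin s) => x (Fin.castLE hst u)) :=
      measurable_pi_lambda _ fun u => measurable_pi_apply _
    exact this.comp (comap_measurable (history X π t))
  le' t := by
    rw [← measurable_iff_comap_le]
    exact measurable_pi_lambda _ fun s => (h s).1.prodMk (h s).2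

/-- The deviation at time `t` of the indicator of a reward in `(-∞, v]` from the probability that
the pulled arm gives to `(-∞, v]`. -/
def deviation (X : Fin K → ℕ → Ω → ℝ) (F : Fin K → Measure ℝ) (π : ℕ → Ω → Fin K) (v : ℝ) (t : ℕ)
    (ω : Ω) : ℝ :=
  (Set.Iic v).indicator (fun _ => (1 : ℝ)) (reward X π t ω) - (F (π t ω)).real (Set.Iic v)

lemma abs_indicator_sub_real_le (F : Measure ℝ) [IsProbabilityMeasure F] (v x : ℝ) :
    |(Set.Iic v).indicator (fun _ => (1 : ℝ)) x - F.real (Set.Iic v)| ≤ 1 := by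
  have h0 : 0 ≤ F.real (Set.Iic v) := measureReal_nonneg
  have h1 : F.real (Set.Iic v) ≤ 1 := measureReal_le_one
  rw [abs_le, Set.indicator_apply]
  split_ifs <;> constructor <;> linarith

lemma measurable_indicator_sub (F : Fin K → Measure ℝ) (v : ℝ) :
    Measurable (fun q : Fin K × ℝ => (Set.Iic v).indicator (fun _ => (1 : ℝ)) q.2
      - (F q.1).real (Set.Iic v)) :=
  ((measurable_const.indicator measurableSet_Iic).comp measurable_snd).sub
    ((measurable_of_countable fun i : Fin K => (F i).real (Set.Iic v)).comp measurable_fst)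

lemma IsBandit.integral_indicator_Iic [MeasurableSpace Ω] [MeasurableSpace 𝕍] {P : Measure Ω}
    {F : Fin K → Measure ℝ} {V : Ω → 𝕍} {X : Fin K → ℕ → Ω → ℝ} (hB : IsBandit P F V X)
    (i : Fin K) (n : ℕ) (v : ℝ) :
    ∫ ω, (Set.Iic v).indicator (fun _ => (1 : ℝ)) (X i n ω) ∂P = (F i).real (Set.Iic v) := by
  rw [← hB.law_X i n, map_measureReal_apply (hB.measurable_X i n) measurableSet_Iic,
    ← integral_indicator_one (hB.measurable_X i n measurableSet_Iic)]
  rfl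

/-- Splitting over the index of the reward received replaces a random index by fixed ones. At time
`t` at most `t` pulls precede, hence `range (t + 1)`. -/
lemma deviation_eq_sum {F : Fin K → Measure ℝ} {X : Fin K → ℕ → Ω → ℝ} {π : ℕ → Ω → Fin K}
    (t : ℕ) (v : ℝ) (ω : Ω) :
    deviation X F π v t ω = ∑ i : Fin K, ∑ n ∈ Finset.range (t + 1),
      {ω | π t ω = i ∧ pullCount π i t ω = n}.indicator
        (fun ω => (Set.Iic v).indicator (fun _ => (1 : ℝ)) (X i n ω)
          - (F i).real (Set.Iic v)) ω := by
  rw [Finset.sum_eq_single (π t ω), Finset.sum_eq_single (pullCount π (π t ω) t ω)]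
  · simp [deviation, reward]
  · intro n _ hn
    simp [hn.symm]
  · intro h
    exact absurd (Finset.mem_range.2 (Nat.lt_succ_of_le (pullCount_le _ _ _ _))) h
  · intro i _ hi
    simp [hi.symm]
  · simp

/-- The integrand is an indicator independent of `X i n` times a centred function of `X i n`, so the
integral factors. -/
lemma IsBandit.setIntegral_othersThan [MeasurableSpace Ω] [MeasurableSpace 𝕍]
    {P : Measure Ω} [IsProbabilityMeasure P] {F : Fin K → Measure ℝ} {V : Ω → 𝕍}
    {X : Fin K → ℕ → Ω → ℝ} (hB : IsBandit P F V X) (i : Fin K) (n : ℕ) (v : ℝ)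
    {D : Set Ω} (hD : MeasurableSet[MeasurableSpace.comap (othersThan V X i n) inferInstance] D) :
    ∫ ω, D.indicator (fun ω => (Set.Iic v).indicator (fun _ => (1 : ℝ)) (X i n ω)
      - (F i).real (Set.Iic v)) ω ∂P = 0 := by
  obtain ⟨C, hC, rfl⟩ := hD
  have hY : Measurable (fun x : ℝ => (Set.Iic v).indicator (fun _ => (1 : ℝ)) x
      - (F i).real (Set.Iic v)) :=
    (measurable_const.indicator measurableSet_Iic).sub_const _
  have hZ : Measurable (C.indicator (fun _ => (1 : ℝ))) := measurable_const.indicator hC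
  have hoth : Measurable (othersThan V X i n) :=
    hB.measurable_V.prodMk (measurable_pi_lambda _ (measurable_zeroAt fun j k _ => hB.measurable_X j k))
  have h := ((hB.indepFun_othersThan i n).comp hZ hY).integral_fun_mul_eq_mul_integral
    (hZ.comp hoth).aestronglyMeasurable (hY.comp (hB.measurable_X i n)).aestronglyMeasurable
  have hint : Integrable (fun ω => (Set.Iic v).indicator (fun _ => (1 : ℝ)) (X i n ω)) P := by
    refine Integrable.of_bound (C := 1)
      ((measurable_const.indicator measurableSet_Iic).comp
        (hB.measurable_X i n)).aestronglyMeasurable (ae_of_all _ fun ω => ?_)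
    rw [Set.indicator_apply]
    split_ifs <;> simp
  have h0 : ∫ ω, ((fun x : ℝ => (Set.Iic v).indicator (fun _ => (1 : ℝ)) x
      - (F i).real (Set.Iic v)) ∘ X i n) ω ∂P = 0 := by
    simp only [Function.comp_def]
    rw [integral_sub hint (integrable_const _), hB.integral_indicator_Iic]
    simp
  rw [h0, mul_zero] at h
  rw [← h]
  refine integral_congr_ae (ae_of_all _ fun ω => ?_)
  by_cases hω : othersThan V X i n ω ∈ C <;> simp [Set.indicator_apply, hω]

/-- If arm `i` has been pulled exactly `n` times, then `X i n` has not been seen yet, so the history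
equals the masked one, which is measurable for the σ-algebra of `othersThan V X i n`. -/
lemma IsAdmissible.measurableSet_history_inter [MeasurableSpace 𝕍] {V : Ω → 𝕍}
    {X : Fin K → ℕ → Ω → ℝ} {π : ℕ → Ω → Fin K} (hπ : IsAdmissible V X π) (i : Fin K) (n t : ℕ)
    {C : Set (Fin t → Fin K × ℝ)} (hC : MeasurableSet C) :
    MeasurableSet[MeasurableSpace.comap (othersThan V X i n) inferInstance]
      (history X π t ⁻¹' C ∩ {ω | π t ω = i ∧ pullCount π i t ω = n}) := by
  let m' : MeasurableSpace Ω := MeasurableSpace.comap (othersThan V X i n) inferInstance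
  have hoth : Measurable[m'] (othersThan V X i n) := comap_measurable (othersThan V X i n)
  have hV : Measurable[m'] V := measurable_fst.comp hoth
  have hX : ∀ j k, (j, k) ≠ (i, n) → Measurable[m'] (X j k) := by
    intro j k hjk
    have := (measurable_pi_apply (j, k)).comp (measurable_snd.comp hoth)
    convert this using 1
    funext ω
    simp [othersThan, zeroAt, hjk]
  have hmask := fun s => @IsAdmissible.measurable_masked Ω 𝕍 K m' _ V X π hπ i n hV hX s
  have hh : Measurable[m']
      (fun ω (s : Fin t) => (maskedAction π i n s ω, maskedReward X π i n s ω)) :=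
    @measurable_pi_lambda _ _ _ m' _ _ fun s => (hmask s).1.prodMk (hmask s).2
  have hE := @IsAdmissible.measurableSet_pullCount_le Ω 𝕍 K m' _ V X π hπ i n hV hX t
  have hN := @measurable_pullCount Ω K m' (maskedAction π i n) t (fun s _ => (hmask s).1) i
  have heq : history X π t ⁻¹' C ∩ {ω | π t ω = i ∧ pullCount π i t ω = n} =
      ({ω | pullCount π i t ω ≤ n} ∩
        (fun ω (s : Fin t) => (maskedAction π i n s ω, maskedReward X π i n s ω)) ⁻¹' C) ∩
      (maskedAction π i n t ⁻¹' {i} ∩ pullCount (maskedAction π i n) i t ⁻¹' {n}) := by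
    ext ω
    by_cases h : pullCount π i t ω ≤ n
    · have h1 : history X π t ω =
          fun s : Fin t => (maskedAction π i n s ω, maskedReward X π i n s ω) := by
        funext s
        rw [maskedAction_eq h s.2.le, maskedReward_eq h s.2]
        rfl
      simp [h, h1, maskedAction_eq h le_rfl, pullCount_maskedAction h]
    · simp only [Set.mem_inter_iff, Set.mem_ofPred_eq, h, false_and, iff_false]
      rintro ⟨_, _, h'⟩
      exact h h'.le
  rw [heq]
  exact (hE.inter (hh hC)).inter
    (((hmask t).1 (measurableSet_singleton i)).inter (hN (measurableSet_singleton n)))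

section

variable [m : MeasurableSpace Ω] [MeasurableSpace 𝕍] {P : Measure Ω} [IsProbabilityMeasure P]
  {F : Fin K → Measure ℝ} [∀ i, IsProbabilityMeasure (F i)] {V : Ω → 𝕍} {X : Fin K → ℕ → Ω → ℝ}
  {π : ℕ → Ω → Fin K}

lemma IsBandit.setIntegral_deviation (hB : IsBandit P F V X) (hπ : IsAdmissible V X π) (v : ℝ)
    (t : ℕ) {C : Set (Fin t → Fin K × ℝ)} (hC : MeasurableSet C) :
    ∫ ω in history X π t ⁻¹' C, deviation X F π v t ω ∂P = 0 := by
  have hm := fun t => hπ.measurable hB.measurable_V hB.measurable_X t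
  have hA : MeasurableSet (history X π t ⁻¹' C) :=
    (measurable_pi_lambda _ fun s : Fin t => (hm s).1.prodMk (hm s).2 :
      Measurable (history X π t)) hC
  have hD : ∀ (i : Fin K) (n : ℕ), MeasurableSet {ω | π t ω = i ∧ pullCount π i t ω = n} :=
    fun i n => ((hm t).1 (measurableSet_singleton i)).inter
      (measurable_pullCount (fun s _ => (hm s).1) i (measurableSet_singleton n))
  have hint : ∀ i n, Integrable ({ω | π t ω = i ∧ pullCount π i t ω = n}.indicator
        (fun ω => (Set.Iic v).indicator (fun _ => (1 : ℝ)) (X i n ω)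
          - (F i).real (Set.Iic v))) (P.restrict (history X π t ⁻¹' C)) := by
    intro i n
    refine Integrable.indicator ?_ (hD i n)
    refine Integrable.of_bound (C := 1) (Measurable.aestronglyMeasurable ?_)
      (ae_of_all _ fun ω => abs_indicator_sub_real_le (F i) v _)
    exact ((measurable_const.indicator measurableSet_Iic).comp (hB.measurable_X i n)).sub_const _
  simp_rw [deviation_eq_sum]
  rw [integral_finsetSum _ fun i _ => integrable_finsetSum _ fun n _ => hint i n]
  refine Finset.sum_eq_zero fun i _ => ?_
  rw [integral_finsetSum _ fun n _ => hint i n]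
  refine Finset.sum_eq_zero fun n _ => ?_
  rw [← integral_indicator hA, Set.indicator_indicator]
  exact hB.setIntegral_othersThan i n v (hπ.measurableSet_history_inter i n t hC)

lemma IsBandit.martingale_sum_deviation (hB : IsBandit P F V X) (hπ : IsAdmissible V X π) (v : ℝ) :
    Martingale (fun t ω => ∑ s ∈ Finset.range t, deviation X F π v s ω)
      (historyFiltration fun t => hπ.measurable hB.measurable_V hB.measurable_X t) P := by
  have hm := fun t => hπ.measurable hB.measurable_V hB.measurable_X t
  have hdm : ∀ s, Measurable (deviation X F π v s) := fun s =>
    (measurable_indicator_sub F v).comp ((hm s).1.prodMk (hm s).2)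
  have hdi : ∀ s, Integrable (deviation X F π v s) P := fun s =>
    Integrable.of_bound (C := 1) (hdm s).aestronglyMeasurable
      (ae_of_all _ fun ω => abs_indicator_sub_real_le (F (π s ω)) v _)
  refine martingale_of_setIntegral_eq_succ (fun t => Measurable.stronglyMeasurable ?_)
    (fun t => integrable_finsetSum _ fun s _ => hdi s) ?_
  · refine Finset.measurable_sum _ fun s hs => ?_
    exact (measurable_indicator_sub F v).comp
      ((measurable_pi_apply (⟨s, Finset.mem_range.1 hs⟩ : Fin t)).comp
        (comap_measurable (history X π t)))
  · rintro t _ ⟨C, hC, rfl⟩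
    simp_rw [Finset.sum_range_succ]
    rw [integral_add (integrable_finsetSum _ fun s _ => hdi s).integrableOn (hdi t).integrableOn,
      hB.setIntegral_deviation hπ v t hC, add_zero]

/-- If every arm gives mass at least `α` to `(-∞, v]`, then almost surely, infinitely often a
proportion at least `α` of the rewards is at most `v`. -/
lemma IsBandit.ae_frequently_le_count (hB : IsBandit P F V X) (hπ : IsAdmissible V X π) {α v : ℝ}
    (hα : α ∈ Set.Ioo (0 : ℝ) 1) (hv : ∀ i, α ≤ (F i).real (Set.Iic v)) :
    ∀ᵐ ω ∂P, ∃ᶠ t : ℕ in atTop, α * t ≤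
      ∑ s ∈ Finset.range t, (Set.Iic v).indicator (fun _ => (1 : ℝ)) (reward X π s ω) := by
  have hbdd : ∀ᵐ ω ∂P, ∀ t, |∑ s ∈ Finset.range (t + 1), deviation X F π v s ω
      - ∑ s ∈ Finset.range t, deviation X F π v s ω| ≤ (1 : NNReal) :=
    ae_of_all _ fun ω t => by
      rw [Finset.sum_range_succ_sub_sum]
      exact abs_indicator_sub_real_le (F (π t ω)) v _
  -- With bounded increments, being bounded above is almost surely equivalent to converging. The
  -- rest is pathwise.
  filter_upwards [(hB.martingale_sum_deviation hπ v).submartingale.bddAbove_iff_exists_tendsto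
    hbdd] with ω hω
  by_contra hcon
  rw [not_frequently] at hcon
  -- Eventually the count is below `α * t`, while the compensator is at least `α * t`.
  have hbd : BddAbove (Set.range fun t => ∑ s ∈ Finset.range t, deviation X F π v s ω) := by
    have : IsBoundedUnder (· ≤ ·) atTop
        (fun t => ∑ s ∈ Finset.range t, deviation X F π v s ω) := by
      refine ⟨0, eventually_map.2 ?_⟩
      filter_upwards [hcon] with t ht
      simp only [deviation, Finset.sum_sub_distrib]
      have : ∑ s ∈ Finset.range t, α ≤
          ∑ s ∈ Finset.range t, (F (π s ω)).real (Set.Iic v) :=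
        Finset.sum_le_sum fun s _ => hv _
      rw [Finset.sum_const, Finset.card_range, nsmul_eq_mul] at this
      linarith
    exact this.bddAbove_range
  obtain ⟨c, hc⟩ := hω.1 hbd
  have hd : Tendsto (fun t => deviation X F π v t ω) atTop (𝓝 0) := by
    have := (hc.comp (tendsto_add_atTop_nat 1)).sub hc
    simpa [Function.comp_def, Finset.sum_range_succ_sub_sum] using this
  -- A reward above `v` has deviation at most `-α`, impossible once the deviation exceeds `-α`.
  have hone : ∀ᶠ t in atTop,
      (Set.Iic v).indicator (fun _ => (1 : ℝ)) (reward X π t ω) = 1 := by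
    filter_upwards [hd.eventually (lt_mem_nhds (neg_lt_zero.2 hα.1))] with t ht
    by_contra hne
    have h0 : (Set.Iic v).indicator (fun _ => (1 : ℝ)) (reward X π t ω) = 0 := by
      rw [Set.indicator_apply] at hne ⊢
      split_ifs at hne ⊢ <;> simp_all
    rw [deviation, h0] at ht
    linarith [hv (π t ω)]
  obtain ⟨T, hT⟩ := eventually_atTop.1 hone
  have hlow : ∀ t : ℕ, (t : ℝ) - T ≤
      ∑ s ∈ Finset.range t, (Set.Iic v).indicator (fun _ => (1 : ℝ)) (reward X π s ω) := by
    intro t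
    induction t with
    | zero => simp
    | succ t ih =>
      rw [Finset.sum_range_succ]
      push_cast
      rcases le_or_gt T t with h | h
      · rw [hT t h]; linarith
      · have h1 : 0 ≤ ∑ s ∈ Finset.range t,
            (Set.Iic v).indicator (fun _ => (1 : ℝ)) (reward X π s ω) :=
          Finset.sum_nonneg fun s _ => Set.indicator_nonneg (fun _ _ => zero_le_one) _
        have h2 : 0 ≤ (Set.Iic v).indicator (fun _ => (1 : ℝ)) (reward X π t ω) :=
          Set.indicator_nonneg (fun _ _ => zero_le_one) _
        have h3 : (t : ℝ) + 1 ≤ T := by exact_mod_cast h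
        linarith
  -- This threshold is where `t - T` reaches `α * t`.
  have hlarge : ∀ᶠ t : ℕ in atTop, (T : ℝ) / (1 - α) ≤ t :=
    tendsto_natCast_atTop_atTop.eventually_ge_atTop _
  obtain ⟨t, ht1, ht2⟩ := (hcon.and hlarge).exists
  rw [div_le_iff₀ (by linarith [hα.2])] at ht2
  nlinarith [hlow t]

end

/-! ### Regrouping by arm and the strong law -/

lemma sum_reward_eq (X : Fin K → ℕ → Ω → ℝ) (π : ℕ → Ω → Fin K) (g : ℝ → ℝ) (t : ℕ) (ω : Ω) :
    ∑ s ∈ Finset.range t, g (reward X π s ω) =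
      ∑ i, ∑ n ∈ Finset.range (pullCount π i t ω), g (X i n ω) := by
  induction t with
  | zero => simp [pullCount]
  | succ t ih =>
    have h : ∀ i, ∑ n ∈ Finset.range (pullCount π i (t + 1) ω), g (X i n ω) =
        ∑ n ∈ Finset.range (pullCount π i t ω), g (X i n ω) +
          if π t ω = i then g (X i (pullCount π i t ω) ω) else 0 := by
      intro i
      rw [pullCount_succ]
      split_ifs
      · rw [Finset.sum_range_succ]
      · simp
    simp_rw [h]
    rw [Finset.sum_range_succ, ih, Finset.sum_add_distrib, Finset.sum_ite_eq]
    simp [reward]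

lemma sum_pullCount (π : ℕ → Ω → Fin K) (t : ℕ) (ω : Ω) :
    ∑ i, (pullCount π i t ω : ℝ) = t := by
  have := sum_reward_eq (fun _ _ _ => 0) π (fun _ => 1) t ω
  simpa using this.symm

lemma IsBandit.ae_tendsto_average [MeasurableSpace Ω] [MeasurableSpace 𝕍] {P : Measure Ω}
    [IsProbabilityMeasure P] {F : Fin K → Measure ℝ} {V : Ω → 𝕍} {X : Fin K → ℕ → Ω → ℝ}
    (hB : IsBandit P F V X) (y : ℝ) (i : Fin K) :
    ∀ᵐ ω ∂P, Tendsto (fun n : ℕ =>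
      (∑ k ∈ Finset.range n, (Set.Iic y).indicator (fun _ => (1 : ℝ)) (X i k ω)) / n) atTop
      (𝓝 ((F i).real (Set.Iic y))) := by
  have hg : Measurable ((Set.Iic y).indicator (fun _ => (1 : ℝ))) :=
    measurable_const.indicator measurableSet_Iic
  rw [← hB.integral_indicator_Iic i 0 y]
  refine strong_law_ae_real
    (fun n ω => (Set.Iic y).indicator (fun _ => (1 : ℝ)) (X i n ω)) ?_ ?_ ?_
  · refine Integrable.of_bound (C := 1) (hg.comp (hB.measurable_X i 0)).aestronglyMeasurable
      (ae_of_all _ fun ω => ?_)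
    rw [Set.indicator_apply]
    split_ifs <;> simp
  · intro k l hkl
    have : ((i, k) : Fin K × ℕ) ≠ (i, l) := fun h => hkl (Prod.mk.inj h).2
    exact (hB.iIndepFun_X.indepFun this).comp hg hg
  · intro n
    have : IdentDistrib (X i n) (X i 0) P P :=
      ⟨(hB.measurable_X i n).aemeasurable, (hB.measurable_X i 0).aemeasurable,
        by rw [hB.law_X, hB.law_X]⟩
    exact this.comp hg

/-- A bound valid for every `n` can be evaluated at the random pull counts, whether or not these
tend to infinity. Indices below the point where the averages drop under `β` are absorbed by the
constant. -/
lemma exists_forall_le_mul_add {S : ℕ → ℝ} {p β : ℝ} (hS : ∀ n, S n ≤ n) (hβ : 0 ≤ β) (hp : p < β)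
    (h : Tendsto (fun n : ℕ => S n / n) atTop (𝓝 p)) : ∃ C, ∀ n, S n ≤ β * n + C := by
  obtain ⟨N, hN⟩ := eventually_atTop.1 (h.eventually (gt_mem_nhds hp))
  refine ⟨N, fun n => ?_⟩
  have h0 : 0 ≤ β * n := by positivity
  have h1 : (0 : ℝ) ≤ N := by positivity
  rcases le_or_gt N n with hn | hn
  · rcases Nat.eq_zero_or_pos n with rfl | hpos
    · have := hS 0
      push_cast at *
      linarith
    · have := (div_lt_iff₀ (by exact_mod_cast hpos)).1 (hN n hn)
      linarith
  · have h2 : (n : ℝ) ≤ N := by exact_mod_cast hn.le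
    linarith [hS n]

/-- If only arms giving mass less than `α` to `(-∞, y]` are pulled, then almost surely the
proportion of the rewards that are at most `y` is eventually less than `α`. -/
lemma IsBandit.ae_eventually_count_lt [MeasurableSpace Ω] [MeasurableSpace 𝕍] {P : Measure Ω}
    [IsProbabilityMeasure P] {F : Fin K → Measure ℝ} {V : Ω → 𝕍} {X : Fin K → ℕ → Ω → ℝ}
    (hB : IsBandit P F V X) (π : ℕ → Ω → Fin K) {α y : ℝ} (hα : 0 < α)
    (hy : ∀ t ω, (F (π t ω)).real (Set.Iic y) < α) :
    ∀ᵐ ω ∂P, ∀ᶠ t : ℕ in atTop,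
      ∑ s ∈ Finset.range t, (Set.Iic y).indicator (fun _ => (1 : ℝ)) (reward X π s ω) < α * t := by
  -- As there are finitely many arms, one `β < α` strictly dominates all masses below `α`. The gap
  -- `α - β` later absorbs the additive constants.
  obtain ⟨β, ⟨hβ0, hβ⟩, hβα⟩ : ∃ β, (0 < β ∧ ∀ i, (F i).real (Set.Iic y) < α →
      (F i).real (Set.Iic y) < β) ∧ β < α := by
    have h1 : ∀ᶠ β in 𝓝[<] α, 0 < β := eventually_nhdsWithin_of_eventually_nhds (lt_mem_nhds hα)
    have h2 : ∀ᶠ β in 𝓝[<] α, ∀ i, (F i).real (Set.Iic y) < α → (F i).real (Set.Iic y) < β :=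
      eventually_all.2 fun i => by
        by_cases h : (F i).real (Set.Iic y) < α
        · filter_upwards [eventually_nhdsWithin_of_eventually_nhds (lt_mem_nhds h)] with β hβ _
          exact hβ
        · exact Eventually.of_forall fun β h' => absurd h' h
    exact ((h1.and h2).and self_mem_nhdsWithin).exists
  filter_upwards [ae_all_iff.2 (hB.ae_tendsto_average y)] with ω hω
  have hC : ∀ i, ∃ C, ∀ t, ∑ n ∈ Finset.range (pullCount π i t ω),
      (Set.Iic y).indicator (fun _ => (1 : ℝ)) (X i n ω) ≤ β * pullCount π i t ω + C := by
    intro i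
    by_cases hi : (F i).real (Set.Iic y) < α
    · have hS : ∀ n : ℕ, ∑ k ∈ Finset.range n,
          (Set.Iic y).indicator (fun _ => (1 : ℝ)) (X i k ω) ≤ n := fun n => by
        refine (Finset.sum_le_card_nsmul _ _ 1 fun k _ => ?_).trans (by simp)
        rw [Set.indicator_apply]
        split_ifs <;> simp
      obtain ⟨C, hC⟩ := exists_forall_le_mul_add hS hβ0.le (hβ i hi) (hω i)
      exact ⟨C, fun t => hC _⟩
    -- An arm with mass at least `α` is never pulled, so its count is `0`.
    · refine ⟨0, fun t => ?_⟩
      have : pullCount π i t ω = 0 := by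
        unfold pullCount
        rw [Finset.card_eq_zero, Finset.filter_eq_empty_iff]
        intro s _ hs
        exact hi (hs ▸ hy s ω)
      simp [this]
  choose C hC using hC
  have hlarge : ∀ᶠ t : ℕ in atTop, (∑ i, C i) / (α - β) < t :=
    tendsto_natCast_atTop_atTop.eventually_gt_atTop _
  filter_upwards [hlarge] with t ht
  rw [div_lt_iff₀ (by linarith)] at ht
  have := Finset.sum_le_sum fun i (_ : i ∈ Finset.univ) => hC i t
  rw [← sum_reward_eq X π ((Set.Iic y).indicator fun _ => (1 : ℝ)), Finset.sum_add_distrib,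
    ← Finset.mul_sum, sum_pullCount] at this
  linarith

/-! ### Quantiles of distribution functions and of empirical distribution functions -/

/-- Since `sInf` on the reals is `0` for an empty or unbounded-below set, nonemptiness and lower
bounds of the superlevel sets must be tracked. -/
lemma le_VaR {α y : ℝ} {F : ℝ → ℝ} (hF : Monotone F) (hne : {z | α ≤ F z}.Nonempty)
    (hy : F y < α) : y ≤ VaR α F :=
  le_csInf hne fun _ hz => le_of_lt (hF.reflect_lt (lt_of_lt_of_le hy hz))

lemma lt_of_lt_VaR {α y : ℝ} {F : ℝ → ℝ} (hb : BddBelow {z | α ≤ F z}) (hy : y < VaR α F) :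
    F y < α :=
  not_le.1 fun h => (csInf_le hb h).not_gt hy

lemma nonempty_setOf_le_cdf (F : Measure ℝ) {α : ℝ} (hα : α < 1) :
    {y | α ≤ cdf F y}.Nonempty :=
  ((tendsto_cdf_atTop F).eventually (lt_mem_nhds hα)).exists.imp fun _ h => h.le

lemma bddBelow_setOf_le_cdf (F : Measure ℝ) {α : ℝ} (hα : 0 < α) :
    BddBelow {y | α ≤ cdf F y} := by
  obtain ⟨z, hz⟩ := ((tendsto_cdf_atBot F).eventually (gt_mem_nhds hα)).exists
  exact ⟨z, fun y hy => le_of_lt ((monotone_cdf F).reflect_lt (hz.trans_le hy))⟩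

/-- Right continuity makes the infimum attained; this is what covers distributions with atoms. -/
lemma le_cdf_VaR (F : Measure ℝ) {α : ℝ} (hα : α < 1) :
    α ≤ cdf F (VaR α (cdf F)) := by
  by_contra! h
  have h1 : ∀ᶠ z in 𝓝[>] (VaR α (cdf F)), cdf F z < α :=
    (((cdf F).right_continuous _).mono Set.Ioi_subset_Ici_self).eventually (gt_mem_nhds h)
  obtain ⟨z, hz1, hz2⟩ := (h1.and self_mem_nhdsWithin).exists
  obtain ⟨y, hy1, hy2⟩ := exists_lt_of_csInf_lt (nonempty_setOf_le_cdf F hα) hz2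
  exact (hz1.trans_le hy1).not_ge (monotone_cdf F hy2.le)

lemma empiricalCDF_eq {t : ℕ} (x : Fin t → ℝ) (y : ℝ) :
    empiricalCDF x y = (1 / (t : ℝ)) * ∑ s, (Set.Iic y).indicator (fun _ => (1 : ℝ)) (x s) := by
  simp [empiricalCDF, Set.indicator_apply]

lemma monotone_empiricalCDF {t : ℕ} (x : Fin t → ℝ) : Monotone (empiricalCDF x) := by
  intro y z hyz
  rw [empiricalCDF_eq, empiricalCDF_eq]
  gcongr

lemma nonempty_setOf_le_empiricalCDF {t : ℕ} (ht : 0 < t) (x : Fin t → ℝ) {α : ℝ} (hα : α ≤ 1) :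
    {y | α ≤ empiricalCDF x y}.Nonempty := by
  have ht' : (t : ℝ) ≠ 0 := by positivity
  obtain ⟨y, hy⟩ := (Set.finite_range x).bddAbove
  refine ⟨y, ?_⟩
  have h : ∀ s, (Set.Iic y).indicator (fun _ => (1 : ℝ)) (x s) = 1 := fun s =>
    Set.indicator_of_mem (s := Set.Iic y) (hy ⟨s, rfl⟩) _
  simpa [empiricalCDF_eq, h, ht'] using hα

lemma bddBelow_setOf_le_empiricalCDF {t : ℕ} (x : Fin t → ℝ) {α : ℝ} (hα : 0 < α) :
    BddBelow {y | α ≤ empiricalCDF x y} := by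
  obtain ⟨z, hz⟩ := (Set.finite_range x).bddBelow
  refine ⟨z, fun y hy => ?_⟩
  by_contra! hlt
  have h : ∀ s, (Set.Iic y).indicator (fun _ => (1 : ℝ)) (x s) = 0 := fun s =>
    Set.indicator_of_notMem (s := Set.Iic y) (fun h => ((hz ⟨s, rfl⟩).trans h).not_gt hlt) _
  simp only [Set.mem_ofPred_eq, empiricalCDF_eq, h, Finset.sum_const_zero, mul_zero] at hy
  linarith

lemma le_empiricalCDF_reward_iff {X : Fin K → ℕ → Ω → ℝ} {π : ℕ → Ω → Fin K} {t : ℕ} (ht : 0 < t)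
    {ω : Ω} {α y : ℝ} : α ≤ empiricalCDF (fun s : Fin t => reward X π s ω) y ↔
      α * t ≤ ∑ s ∈ Finset.range t, (Set.Iic y).indicator (fun _ => (1 : ℝ)) (reward X π s ω) := by
  have ht' : (0 : ℝ) < t := by positivity
  rw [empiricalCDF_eq, one_div_mul_eq_div, le_div_iff₀ ht', Finset.sum_range]

lemma measurable_VaR_empiricalCDF {α : ℝ} (hα : α ∈ Set.Ioo (0 : ℝ) 1) (t : ℕ) :
    Measurable (fun x : Fin t → ℝ => VaR α (empiricalCDF x)) := by
  rcases Nat.eq_zero_or_pos t with rfl | ht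
  · exact Subsingleton.measurable
  refine measurable_of_Iio fun y => ?_
  -- By monotonicity, a point of the superlevel set below `y` may be moved up to a rational one,
  -- making the union countable.
  have heq : (fun x : Fin t → ℝ => VaR α (empiricalCDF x)) ⁻¹' Set.Iio y =
      ⋃ q : ℚ, ⋃ _ : (q : ℝ) < y, {x : Fin t → ℝ | α ≤ empiricalCDF x q} := by
    ext x
    simp only [Set.mem_preimage, Set.mem_Iio, Set.mem_iUnion, Set.mem_ofPred_eq, exists_prop]
    constructor
    · intro h
      obtain ⟨z, hz1, hz2⟩ := exists_lt_of_csInf_lt (nonempty_setOf_le_empiricalCDF ht x hα.2.le) h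
      obtain ⟨q, hq1, hq2⟩ := exists_rat_btwn hz2
      exact ⟨q, hq2, le_trans hz1 (monotone_empiricalCDF x hq1.le)⟩
    · rintro ⟨q, hq1, hq2⟩
      exact (csInf_le (bddBelow_setOf_le_empiricalCDF x hα.1) hq2).trans_lt hq1
  rw [heq]
  refine MeasurableSet.iUnion fun q => MeasurableSet.iUnion fun _ =>
    measurableSet_le measurable_const ?_
  simp_rw [empiricalCDF_eq]
  refine measurable_const.mul (Finset.measurable_sum _ fun s _ => ?_)
  exact (measurable_const.indicator measurableSet_Iic).comp (measurable_pi_apply s)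

/-! ### Almost sure bounds on the performance and the optimal arm -/

lemma isAdmissible_const [MeasurableSpace 𝕍] (V : Ω → 𝕍) (X : Fin K → ℕ → Ω → ℝ) (i : Fin K) :
    IsAdmissible V X (fun _ _ => i) :=
  fun _ => ⟨fun _ => i, measurable_const, fun _ => rfl⟩

section

variable [MeasurableSpace Ω] [MeasurableSpace 𝕍] {P : Measure Ω} [IsProbabilityMeasure P]
  {F : Fin K → Measure ℝ} [∀ i, IsProbabilityMeasure (F i)] {V : Ω → 𝕍} {X : Fin K → ℕ → Ω → ℝ}
  {π : ℕ → Ω → Fin K} {α : ℝ}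

lemma measurable_performance (hα : α ∈ Set.Ioo (0 : ℝ) 1)
    (h : ∀ t, Measurable (reward X π t)) : Measurable (performance X (VaR α) π) := by
  refine Measurable.liminf fun t => measurable_coe_real_ereal.comp ?_
  exact (measurable_VaR_empiricalCDF hα t).comp (measurable_pi_lambda _ fun s => h s)

lemma IsBandit.ae_performance_le (hB : IsBandit P F V X) (hπ : IsAdmissible V X π)
    (hα : α ∈ Set.Ioo (0 : ℝ) 1) {v : ℝ} (hv : ∀ i, VaR α (cdf (F i)) ≤ v) :
    ∀ᵐ ω ∂P, performance X (VaR α) π ω ≤ v := by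
  have hv' : ∀ i, α ≤ (F i).real (Set.Iic v) := fun i => by
    rw [← cdf_eq_real]
    exact (le_cdf_VaR (F i) hα.2).trans (monotone_cdf _ (hv i))
  filter_upwards [hB.ae_frequently_le_count hπ hα hv'] with ω hω
  -- A bound at infinitely many times suffices for a liminf. Time `0` is discarded because the
  -- empirical distribution function is then identically `0`.
  refine liminf_le_of_frequently_le' ?_
  refine (hω.and_eventually (eventually_gt_atTop 0)).mono fun t ht => ?_
  exact EReal.coe_le_coe_iff.2 (csInf_le (bddBelow_setOf_le_empiricalCDF _ hα.1)
    ((le_empiricalCDF_reward_iff ht.2).2 ht.1))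

/-- Only the arms actually pulled enter `hw`, so the lemma serves both for the smallest `VaR` of all
arms and for a constant policy with its own `VaR`. -/
lemma IsBandit.le_ae_performance (hB : IsBandit P F V X) (hα : α ∈ Set.Ioo (0 : ℝ) 1) {w : ℝ}
    (hw : ∀ t ω, w ≤ VaR α (cdf (F (π t ω)))) :
    ∀ᵐ ω ∂P, (w : EReal) ≤ performance X (VaR α) π ω := by
  -- The mass of `(-∞, w]` may reach `α`, so levels strictly below `w` are used; a sequence of them
  -- keeps the exceptional set null.
  have hlim : Tendsto (fun n : ℕ => ((w - 1 / ((n : ℝ) + 1) : ℝ) : EReal)) atTop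
      (𝓝 (w : EReal)) := by
    refine (continuous_coe_real_ereal.tendsto w).comp ?_
    simpa using tendsto_const_nhds.sub (tendsto_one_div_add_atTop_nhds_zero_nat (𝕜 := ℝ))
  have hev : ∀ᵐ ω ∂P, ∀ n : ℕ, ∀ᶠ t : ℕ in atTop,
      ∑ s ∈ Finset.range t, (Set.Iic (w - 1 / ((n : ℝ) + 1))).indicator (fun _ => (1 : ℝ))
        (reward X π s ω) < α * t := by
    refine ae_all_iff.2 fun n => hB.ae_eventually_count_lt π hα.1 fun t ω => ?_
    rw [← cdf_eq_real]
    refine lt_of_lt_VaR (bddBelow_setOf_le_cdf _ hα.1) (lt_of_lt_of_le ?_ (hw t ω))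
    have : 0 < 1 / ((n : ℝ) + 1) := by positivity
    linarith
  filter_upwards [hev] with ω hω
  refine le_of_tendsto' hlim fun n => le_liminf_of_le (by isBoundedDefault) ?_
  filter_upwards [hω n, eventually_gt_atTop 0] with t ht ht0
  exact EReal.coe_le_coe_iff.2 (le_VaR (monotone_empiricalCDF _)
    (nonempty_setOf_le_empiricalCDF ht0 _ hα.2.le)
    (not_le.1 fun h => ((le_empiricalCDF_reward_iff ht0).1 h).not_gt ht))

lemma iIndepFun_const {ι β : Type*} [MeasurableSpace β] (c : β) :
    iIndepFun (fun (_ : ι) (_ : Ω) => c) P := by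
  rw [iIndepFun_iff_measure_inter_preimage_eq_mul]
  intro S sets _
  by_cases h : ∀ i ∈ S, c ∈ sets i
  · rw [Finset.prod_eq_one fun i hi => by simp [h i hi]]
    convert measure_univ (μ := P)
    ext ω
    simpa using h
  · push Not at h
    obtain ⟨i, hi, hc⟩ := h
    rw [Finset.prod_eq_zero hi (by simp [hc])]
    refine measure_mono_null (Set.iInter₂_subset i hi) ?_
    simp [hc]

lemma isDeterministicSimple_const (i : Fin K) : IsDeterministicSimple P V X (fun _ _ => i) :=
  ⟨⟨isAdmissible_const V X i, fun _ => measurable_const, iIndepFun_const i,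
    fun _ => IdentDistrib.refl measurable_const.aemeasurable⟩, i, by simp⟩

lemma IsBandit.hasExpectedPerformance (hB : IsBandit P F V X) (hπ : IsAdmissible V X π)
    (hα : α ∈ Set.Ioo (0 : ℝ) 1) {v w : ℝ} (hv : ∀ i, VaR α (cdf (F i)) ≤ v)
    (hw : ∀ i, w ≤ VaR α (cdf (F i))) :
    HasExpectedPerformance P X (VaR α) π ∧ expectedPerformance P X (VaR α) π ≤ v := by
  have hle := hB.ae_performance_le hπ hα hv
  have hge := hB.le_ae_performance hα (π := π) fun t ω => hw (π t ω)
  have hfin : ∀ᵐ ω ∂P, performance X (VaR α) π ω ≠ ⊥ ∧ performance X (VaR α) π ω ≠ ⊤ := by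
    filter_upwards [hle, hge] with ω h1 h2
    exact ⟨ne_bot_of_le_ne_bot (EReal.coe_ne_bot w) h2, ne_top_of_le_ne_top (EReal.coe_ne_top v) h1⟩
  have hbd : ∀ᵐ ω ∂P, (performance X (VaR α) π ω).toReal ∈ Set.Icc w v := by
    filter_upwards [hle, hge, hfin] with ω h1 h2 h3
    rw [← EReal.coe_toReal h3.2 h3.1] at h1 h2
    exact ⟨EReal.coe_le_coe_iff.1 h2, EReal.coe_le_coe_iff.1 h1⟩
  have hmeas : Measurable fun ω => (performance X (VaR α) π ω).toReal :=
    (measurable_performance hα fun t =>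
      (hπ.measurable hB.measurable_V hB.measurable_X t).2).ereal_toReal
  have hint := Integrable.of_mem_Icc w v hmeas.aemeasurable hbd
  refine ⟨⟨hfin, hint⟩, ?_⟩
  calc expectedPerformance P X (VaR α) π ≤ ∫ _, v ∂P :=
        integral_mono_ae hint (integrable_const v) (hbd.mono fun ω h => h.2)
    _ = v := by simp

/-- For the best arm the almost sure upper and lower bounds coincide. -/
lemma IsBandit.expectedPerformance_const (hB : IsBandit P F V X) (hα : α ∈ Set.Ioo (0 : ℝ) 1)
    {i : Fin K} (hi : ∀ j, VaR α (cdf (F j)) ≤ VaR α (cdf (F i))) :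
    expectedPerformance P X (VaR α) (fun _ _ => i) = VaR α (cdf (F i)) := by
  have hle := hB.ae_performance_le (isAdmissible_const V X i) hα hi
  have hge := hB.le_ae_performance hα (π := fun _ _ => i) fun _ _ => le_rfl
  have h : ∀ᵐ ω ∂P, (performance X (VaR α) (fun _ _ => i) ω).toReal = VaR α (cdf (F i)) := by
    filter_upwards [hle, hge] with ω h1 h2
    rw [le_antisymm h1 h2, EReal.toReal_coe]
  rw [expectedPerformance, integral_congr_ae h]
  simp

end

end BanditEDPM

end

open BanditEDPM in
theorem mainTheorem7 {K : ℕ} (hK : 0 < K) (F : Fin K → Measure ℝ)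
    [∀ i, IsProbabilityMeasure (F i)] (α : ℝ) (hα : α ∈ Set.Ioo (0 : ℝ) 1) :
    ∃ i : Fin K, ∀ (Ω 𝕍 : Type*) [MeasurableSpace Ω] [MeasurableSpace 𝕍]
      (P : Measure Ω) [IsProbabilityMeasure P] (V : Ω → 𝕍) (X : Fin K → ℕ → Ω → ℝ),
      BanditEDPM.IsBandit P F V X →
        BanditEDPM.IsDeterministicSimple P V X (fun _ _ => i) ∧
        BanditEDPM.IsInfiniteHorizonOracle P V X (BanditEDPM.VaR α) (fun _ _ => i) := by
  have : Nonempty (Fin K) := ⟨⟨0, hK⟩⟩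
  obtain ⟨i, hi⟩ := Finite.exists_max fun i => VaR α (cdf (F i))
  obtain ⟨j, hj⟩ := Finite.exists_min fun i => VaR α (cdf (F i))
  refine ⟨i, fun Ω 𝕍 _ _ P _ V X hB => ⟨isDeterministicSimple_const i, isAdmissible_const V X i,
    fun π hπ => ?_⟩⟩
  rw [hB.expectedPerformance_const hα hi]
  exact hB.hasExpectedPerformance hπ hα hi hj
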